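/- Let $f$ be a function that is holomorphic on an open neighbourhood of the unit circle and does not vanish on the circle, and suppose that $\ln f$ is also holomorphic on such a neighbourhood (that is, $f$ has a holomorphic logarithm there). For $\eta>0$ let $\partial\mathcal D_\eta$ be the counterclockwise circle of radius $\eta$ centred at $0$, and put $$c_n[g]=\oint_{\partial\mathcal D_1}\frac{g(z)}{z^{n+1}}\,\frac{dz}{2i\pi}\quad(n\in\mathbb Z),$$ $$\alpha(z)=\exp\Big\{-\sum_{n\ge 0}c_n[\ln f]\,z^n\Big\}\ \ (|z|<1),\qquad \alpha(z)=\exp\Big\{\sum_{n\ge 1}c_{-n}[\ln f]\,z^{-n}\Big\}\ \ (|z|>1).$$ Fix $1>\eta_z>\eta_s>0$. For $N\in\mathbb N$ and integers $p_1,\dots,p_n$, $h_1,\dots,h_n$, let $M$ be the $n\times n$ matrix $$M_{ab}=-\mathbf 1_{\mathbb N}(p_a)\oint_{\partial\mathcal D_{\eta_z}}\frac{dz}{2i\pi}\oint_{\partial\mathcal D_{\eta_s}}\frac{ds}{2i\pi}\,\frac{\alpha(z)}{\alpha(s)}\,\frac{s^{N-p_a}z^{h_b-N-1}}{z-s} +\mathbf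 1_{\mathbb N}(-p_a)\oint_{\partial\mathcal D_{\eta_z^{-1}}}\frac{dz}{2i\pi}\oint_{\partial\mathcal D_{\eta_s^{-1}}}\frac{ds}{2i\pi}\,\frac{\alpha(s)}{\alpha(z)}\,\frac{s^{-p_a}z^{h_b-1}}{z-s},$$ where $0\in\mathbb N$. Let $n=n_-+n_+$ and suppose that $$p_a=1-p_a^-,\quad h_a=h_a^-\quad(a=1,\dots,n_-),\qquad p_{a+n_-}=p_a^++N,\quad h_{a+n_-}=N+1-h_a^+\quad(a=1,\dots,n_+),$$ with integers $p_a^\pm,h_a^\pm\ge 1$ independent of $N$. Define the $n_\pm\times n_\pm$ matrices $$M^{(+)}_{ab}=-\oint_{\partial\mathcal D_{\eta_z}}\frac{dz}{2i\pi}\oint_{\partial\mathcal D_{\eta_s}}\frac{ds}{2i\pi}\,\frac{s^{-p_a^+}z^{-h_b^+}}{z-s}\,\frac{\alpha(z)}{\alpha(s)},\qquad M^{(-)}_{ab}=\oint_{\partial\mathcal D_{\eta_z^{-1}}}\frac{dz}{2i\pi}\oint_{\partial\mathcal D_{\eta_s^{-1}}}\frac{ds}{2i\pi}\,\frac{s^{p_a^--1}z^{h_b^--1}}{z-s}\,\frac{\alpha(s)}{\alpha(z)}.$$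 If $M^{(+)}$ and $M^{(-)}$ are non-singular (a $0\times 0$ matrix has determinant $1$), then, as $N\to\infty$, $$\det\nolimits_n[M]=\det\nolimits_{n_+}[M^{(+)}]\cdot\det\nolimits_{n_-}[M^{(-)}]\cdot\big(1+O(N^{-\infty})\big),$$ where $O(N^{-\infty})$ denotes a quantity that is $O(N^{-k})$ for every $k\in\mathbb N$. -/

import Mathlib

open Filter Asymptotics

noncomputable section

/-- The Laurent coefficient `c_n[g] = ∮_{|z| = 1} g(z) / z^(n+1) dz / (2iπ)`. -/
def laurentCoeff (g : ℂ → ℂ) (n : ℤ) : ℂ :=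
  (2 * Real.pi * Complex.I)⁻¹ * ∮ z in C(0, 1), g z / z ^ (n + 1)

/-- The piecewise analytic function `α` built from `g = ln f`: it is
`exp (- ∑_{n ≥ 0} c_n[g] z^n)` for `|z| < 1` and `exp (∑_{n ≥ 1} c_{-n}[g] z^(-n))` for `|z| > 1`.
(The value on the unit circle itself is never used.) -/
def szegoAlpha (g : ℂ → ℂ) (z : ℂ) : ℂ :=
  if ‖z‖ < 1 then Complex.exp (-∑' n : ℕ, laurentCoeff g n * z ^ n)
  else Complex.exp (∑' n : ℕ, laurentCoeff g (-(n + 1 : ℤ)) * z ^ (-(n + 1 : ℤ)))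

/-- `∮_{|z| = ηz} dz/(2iπ) ∮_{|s| = ηs} ds/(2iπ) α(z)/α(s) · s^u z^v / (z - s)`,
used with radii smaller than one. -/
def innerDoubleIntegral (α : ℂ → ℂ) (ηz ηs : ℝ) (u v : ℤ) : ℂ :=
  (2 * Real.pi * Complex.I)⁻¹ * ∮ z in C(0, ηz),
    (2 * Real.pi * Complex.I)⁻¹ * ∮ s in C(0, ηs),
      α z / α s * (s ^ u * z ^ v / (z - s))

/-- `∮_{|z| = 1/ηz} dz/(2iπ) ∮_{|s| = 1/ηs} ds/(2iπ) α(s)/α(z) · s^u z^v / (z - s)`,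
used with `ηz, ηs` smaller than one. -/
def outerDoubleIntegral (α : ℂ → ℂ) (ηz ηs : ℝ) (u v : ℤ) : ℂ :=
  (2 * Real.pi * Complex.I)⁻¹ * ∮ z in C(0, ηz⁻¹),
    (2 * Real.pi * Complex.I)⁻¹ * ∮ s in C(0, ηs⁻¹),
      α s / α z * (s ^ u * z ^ v / (z - s))

/-- The `n × n` matrix `M` attached to the line-lacunary data `p`, `h` and the size `N`. The two
conditions are the indicator functions of `ℕ ∋ 0` evaluated at `p a` and at `-p a`. -/
def lacunaryMatrix (α : ℂ → ℂ) (ηz ηs : ℝ) (N : ℕ) {n : ℕ} (p h : Fin n → ℤ) :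
    Matrix (Fin n) (Fin n) ℂ :=
  Matrix.of fun a b =>
    -(if 0 ≤ p a then 1 else 0) * innerDoubleIntegral α ηz ηs (N - p a) (h b - N - 1)
      + (if 0 ≤ -p a then 1 else 0) * outerDoubleIntegral α ηz ηs (-p a) (h b - 1)

/-- The `N`-independent matrix `M⁽⁺⁾`. -/
def matrixPlus (α : ℂ → ℂ) (ηz ηs : ℝ) {n : ℕ} (p h : Fin n → ℤ) :
    Matrix (Fin n) (Fin n) ℂ :=
  Matrix.of fun a b => -innerDoubleIntegral α ηz ηs (-p a) (-h b)

/-- The `N`-independent matrix `M⁽⁻⁾`. -/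
def matrixMinus (α : ℂ → ℂ) (ηz ηs : ℝ) {n : ℕ} (p h : Fin n → ℤ) :
    Matrix (Fin n) (Fin n) ℂ :=
  Matrix.of fun a b => outerDoubleIntegral α ηz ηs (p a - 1) (h b - 1)

/-- The integers `p_a = 1 - p_a⁻` for `a = 1, …, n₋` and `p_{a + n₋} = p_a⁺ + N` for
`a = 1, …, n₊`. -/
def lacunaryP {nm np : ℕ} (pm : Fin nm → ℤ) (pp : Fin np → ℤ) (N : ℕ) : Fin (nm + np) → ℤ :=
  Fin.append (fun a => 1 - pm a) (fun a => pp a + N)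

/-- The integers `h_a = h_a⁻` for `a = 1, …, n₋` and `h_{a + n₋} = N + 1 - h_a⁺` for
`a = 1, …, n₊`. -/
def lacunaryH {nm np : ℕ} (hm : Fin nm → ℤ) (hp : Fin np → ℤ) (N : ℕ) : Fin (nm + np) → ℤ :=
  Fin.append (fun a => hm a) (fun a => N + 1 - hp a)

/-- `ε_N = O(N^{-∞})`: `ε_N = O(N^{-k})` as `N → ∞`, for every `k`. -/
def IsBigONegInfty (ε : ℕ → ℂ) : Prop :=
  ∀ k : ℕ, ε =O[atTop] fun N : ℕ => ((N : ℝ) ^ k)⁻¹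

end

/-! Holomorphy of `logf` on an annulus around the unit circle gives geometric decay of its Laurent
coefficients, so each branch of α, and its inverse, continues holomorphically across the circle. In
every double integral the `z`-contour lies on the unit-circle side of the `s`-contour, so it can be
pushed through the circle without meeting the pole `z = s`.

With rows and columns split into minus and plus types, the diagonal blocks contain `M⁽⁻⁾` and
`M⁽⁺⁾`; the only further term there carries `(s/z)^N` with `|s| < |z|`. Every term of the
off-diagonal blocks carries `s^N` with `|s| < 1`, `z^N` that is small once `|z| < 1`, or `z^(-N)`
that is small once `|z| > 1`. Hence the matrix is exponentially close to a constant block diagonal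
one (`isBigONegInfty_lacunaryMatrix_sub_fromBlocks`). The determinant is polynomial in the entries,
so it inherits the error, and division by the nonzero limit makes the error relative. -/

/-- Circle integrals of a function that is holomorphic on the closed annulus between two concentric
circles agree. -/
theorem circleIntegral_eq_of_differentiableAt_annulus {g : ℂ → ℂ} {r R : ℝ} (hr : 0 < r)
    (hR : 0 < R) (hg : ∀ z : ℂ, ‖z‖ ∈ Set.uIcc r R → DifferentiableAt ℂ g z) :
    (∮ z in C(0, r), g z) = ∮ z in C(0, R), g z := by
  wlog h : r ≤ R generalizing r R
  · exact (this hR hr (by rwa [Set.uIcc_comm]) (le_of_not_ge h)).symm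
  rw [Set.uIcc_of_le h] at hg
  refine (Complex.circleIntegral_eq_of_differentiable_on_annulus_off_countable hr h
    Set.countable_empty (fun z hz => ?_) fun z hz => ?_).symm
  · refine (hg z ?_).continuousAt.continuousWithinAt
    simpa [and_comm] using hz
  · refine hg z ?_
    have := hz.1
    simp only [Set.mem_sdiff, Metric.mem_ball, dist_zero_right, Metric.mem_closedBall,
      not_le] at this
    exact ⟨this.2.le, this.1.le⟩

/-- Fubini's theorem for circle integrals of a continuous function. -/
theorem circleIntegral_circleIntegral_swap {F : ℂ → ℂ → ℂ} {r R : ℝ} (hr : 0 ≤ r) (hR : 0 ≤ R)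
    (hF : ContinuousOn (Function.uncurry F) (Metric.sphere 0 r ×ˢ Metric.sphere 0 R)) :
    (∮ z in C(0, r), ∮ s in C(0, R), F z s) = ∮ s in C(0, R), ∮ z in C(0, r), F z s := by
  have hc : Continuous (fun q : ℝ × ℝ => F (circleMap 0 r q.1) (circleMap 0 R q.2)) :=
    hF.comp_continuous (f := fun q : ℝ × ℝ => (circleMap 0 r q.1, circleMap 0 R q.2))
      (by fun_prop) fun q => ⟨circleMap_mem_sphere _ hr _, circleMap_mem_sphere _ hR _⟩
  have hc' : Continuous (fun q : ℝ × ℝ => deriv (circleMap 0 r) q.1 •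
      deriv (circleMap 0 R) q.2 • F (circleMap 0 r q.1) (circleMap 0 R q.2)) := by
    simp only [deriv_circleMap]
    have h1 : Continuous fun q : ℝ × ℝ => circleMap 0 r q.1 * Complex.I := by fun_prop
    have h2 : Continuous fun q : ℝ × ℝ => circleMap 0 R q.2 * Complex.I := by fun_prop
    exact h1.smul (h2.smul hc)
  simp only [circleIntegral, ← intervalIntegral.integral_smul]
  rw [MeasureTheory.intervalIntegral_intervalIntegral_swap]
  · simp only [smul_comm (deriv (circleMap 0 r) _)]
  · rw [Set.uIoc_of_le Real.two_pi_pos.le]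
    exact (hc'.continuousOn.integrableOn_compact
      (isCompact_Icc.prod isCompact_Icc)).mono_set
      (Set.prod_mono Set.Ioc_subset_Icc_self Set.Ioc_subset_Icc_self)

/-! ### Double Cauchy integrals: bounds and contour deformation -/

/-- The double contour integral of `A z * B s * s ^ u * z ^ v / (z - s)` over `|z| = ρ`, `|s| = σ`,
normalised by `(2iπ)⁻²`. -/
noncomputable def cauchyDoubleIntegral (A B : ℂ → ℂ) (ρ σ : ℝ) (u v : ℤ) : ℂ :=
  (2 * Real.pi * Complex.I)⁻¹ * ∮ z in C(0, ρ),
    (2 * Real.pi * Complex.I)⁻¹ * ∮ s in C(0, σ), A z * B s * (s ^ u * z ^ v / (z - s))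

/-- Only values on the two contours matter, so the piecewise α may be traded for functions that
continue across the unit circle. -/
theorem innerDoubleIntegral_eq {α A B : ℂ → ℂ} {ηz ηs : ℝ} (hz : 0 ≤ ηz) (hs : 0 ≤ ηs)
    (hA : ∀ z ∈ Metric.sphere (0 : ℂ) ηz, α z = A z)
    (hB : ∀ s ∈ Metric.sphere (0 : ℂ) ηs, (α s)⁻¹ = B s) (u v : ℤ) :
    innerDoubleIntegral α ηz ηs u v = cauchyDoubleIntegral A B ηz ηs u v := by
  unfold innerDoubleIntegral cauchyDoubleIntegral
  congr 1
  refine circleIntegral.integral_congr hz fun z hz => ?_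
  congr 1
  refine circleIntegral.integral_congr hs fun s hs => ?_
  rw [hA z hz, ← hB s hs, div_eq_mul_inv (A z)]

theorem outerDoubleIntegral_eq {α A B : ℂ → ℂ} {ηz ηs : ℝ} (hz : 0 ≤ ηz) (hs : 0 ≤ ηs)
    (hA : ∀ z ∈ Metric.sphere (0 : ℂ) ηz⁻¹, (α z)⁻¹ = A z)
    (hB : ∀ s ∈ Metric.sphere (0 : ℂ) ηs⁻¹, α s = B s) (u v : ℤ) :
    outerDoubleIntegral α ηz ηs u v = cauchyDoubleIntegral A B ηz⁻¹ ηs⁻¹ u v := by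
  unfold outerDoubleIntegral cauchyDoubleIntegral
  congr 1
  refine circleIntegral.integral_congr (inv_nonneg.2 hz) fun z hz => ?_
  congr 1
  refine circleIntegral.integral_congr (inv_nonneg.2 hs) fun s hs => ?_
  rw [← hA z hz, hB s hs, div_eq_mul_inv, mul_comm (B s)]

/-- The double integral over `|z| = ρ`, `|s| = σ` is bounded by a multiple of `σ ^ u * ρ ^ v`. -/
theorem exists_norm_cauchyDoubleIntegral_le {A B : ℂ → ℂ} {ρ σ : ℝ} (hρ : 0 < ρ) (hσ : 0 < σ)
    (hne : ρ ≠ σ) (hA : ContinuousOn A (Metric.sphere 0 ρ))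
    (hB : ContinuousOn B (Metric.sphere 0 σ)) :
    ∃ C, ∀ u v : ℤ, ‖cauchyDoubleIntegral A B ρ σ u v‖ ≤ C * (σ ^ u * ρ ^ v) := by
  obtain ⟨a, ha⟩ := (isCompact_sphere (0 : ℂ) ρ).exists_bound_of_continuousOn hA
  obtain ⟨b, hb⟩ := (isCompact_sphere (0 : ℂ) σ).exists_bound_of_continuousOn hB
  have hd : 0 < |ρ - σ| := abs_pos.2 (sub_ne_zero.2 hne)
  -- `ρ` and `σ` are the contour lengths divided by `2π`; `|ρ - σ|` bounds `|z - s|` from below.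
  refine ⟨ρ * (σ * (a * b / |ρ - σ|)), fun u v => ?_⟩
  have key := circleIntegral.norm_two_pi_i_inv_smul_integral_le_of_norm_le_const (c := (0 : ℂ))
    (f := fun z => (2 * Real.pi * Complex.I)⁻¹ *
      ∮ s in C(0, σ), A z * B s * (s ^ u * z ^ v / (z - s)))
    (C := σ * (a * b * (σ ^ u * ρ ^ v / |ρ - σ|))) hρ.le fun z hz => by
    refine circleIntegral.norm_two_pi_i_inv_smul_integral_le_of_norm_le_const (c := (0 : ℂ))
      hσ.le fun s hs => ?_
    have hz' : ‖z‖ = ρ := by simpa using hz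
    have hs' : ‖s‖ = σ := by simpa using hs
    rw [norm_mul, norm_mul, norm_div, norm_mul, norm_zpow, norm_zpow, hz', hs']
    have h1 : |ρ - σ| ≤ ‖z - s‖ := by
      simpa [hz', hs'] using abs_norm_sub_norm_le z s
    have ha0 := (norm_nonneg _).trans (ha z hz)
    have hb0 := (norm_nonneg _).trans (hb s hs)
    have hab := mul_nonneg ha0 hb0
    have := ha z hz
    have := hb s hs
    gcongr
  refine key.trans (le_of_eq ?_)
  ring

/-- The `z`-contour of the double integral can be moved through an annulus on which `A` is
holomorphic and which avoids the `s`-contour. -/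
theorem cauchyDoubleIntegral_eq_of_annulus {A B : ℂ → ℂ} {ρ ρ' σ : ℝ} (hρ : 0 < ρ) (hρ' : 0 < ρ')
    (hσ : 0 < σ) (hσρ : σ ∉ Set.uIcc ρ ρ')
    (hA : ∀ z : ℂ, ‖z‖ ∈ Set.uIcc ρ ρ' → DifferentiableAt ℂ A z)
    (hB : ContinuousOn B (Metric.sphere 0 σ)) (u v : ℤ) :
    cauchyDoubleIntegral A B ρ σ u v = cauchyDoubleIntegral A B ρ' σ u v := by
  have hne : ∀ z s : ℂ, ‖z‖ ∈ Set.uIcc ρ ρ' → s ∈ Metric.sphere (0 : ℂ) σ → z - s ≠ 0 := by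
    intro z s hz hs h
    rw [sub_eq_zero.1 h] at hz
    simp only [mem_sphere_iff_norm, sub_zero] at hs
    exact hσρ (hs ▸ hz)
  have hz0 : ∀ z : ℂ, ‖z‖ ∈ Set.uIcc ρ ρ' → z ≠ 0 := by
    rintro z hz rfl
    rw [norm_zero] at hz
    exact absurd hz.1 (not_le.2 (lt_min hρ hρ'))
  have hcont : ∀ r ∈ Set.uIcc ρ ρ', ContinuousOn
      (Function.uncurry fun z s : ℂ => A z * B s * (s ^ u * z ^ v / (z - s)))
      (Metric.sphere 0 r ×ˢ Metric.sphere 0 σ) := by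
    intro r hr
    have hmem : ∀ q ∈ Metric.sphere (0 : ℂ) r ×ˢ Metric.sphere (0 : ℂ) σ,
        ‖q.1‖ ∈ Set.uIcc ρ ρ' := fun q hq => by
      have : ‖q.1‖ = r := by simpa using hq.1
      rwa [this]
    refine ContinuousOn.mul (ContinuousOn.mul ?_ ?_) (ContinuousOn.div (ContinuousOn.mul ?_ ?_)
      (by fun_prop) fun q hq => hne q.1 q.2 (hmem q hq) hq.2)
    · exact fun q hq => ((hA q.1 (hmem q hq)).continuousAt.comp
        continuousAt_fst).continuousWithinAt
    · exact hB.comp continuousOn_snd fun q hq => hq.2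
    · refine continuousOn_snd.zpow₀ u fun q hq => Or.inl ?_
      exact Metric.ne_of_mem_sphere hq.2 hσ.ne'
    · exact continuousOn_fst.zpow₀ v fun q hq => Or.inl (hz0 q.1 (hmem q hq))
  unfold cauchyDoubleIntegral
  congr 1
  simp only [circleIntegral.integral_const_mul]
  congr 1
  -- After the swap the `z`-integral is innermost, and its contour is moved separately for each
  -- fixed `s`.
  rw [circleIntegral_circleIntegral_swap hρ.le hσ.le (hcont _ Set.left_mem_uIcc),
    circleIntegral_circleIntegral_swap hρ'.le hσ.le (hcont _ Set.right_mem_uIcc)]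
  refine circleIntegral.integral_congr hσ.le fun s hs => ?_
  refine circleIntegral_eq_of_differentiableAt_annulus hρ hρ' fun z hz => ?_
  refine ((hA z hz).mul_const _).mul (DifferentiableAt.div ?_ (by fun_prop) (hne z s hz hs))
  exact (differentiableAt_id.zpow (Or.inl (hz0 z hz))).const_mul _

/-! ### Continuation of the Szegő exponents across the unit circle -/

theorem exists_annulus_subset_of_sphere_subset {U : Set ℂ} (hU : IsOpen U)
    (hcircle : Metric.sphere (0 : ℂ) 1 ⊆ U) :
    ∃ δ : ℝ, 0 < δ ∧ δ < 1 ∧ ∀ z : ℂ, |‖z‖ - 1| ≤ δ → z ∈ U := by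
  obtain ⟨δ, hδ, hsub⟩ := (isCompact_sphere (0 : ℂ) 1).exists_cthickening_subset_open hU hcircle
  refine ⟨min δ (1 / 2), by positivity, (min_le_right _ _).trans_lt (by norm_num),
    fun z hz => hsub ?_⟩
  have hz0 : z ≠ 0 := by
    rintro rfl
    have := hz.trans (min_le_right _ _)
    norm_num at this
  have hn : (‖z‖ : ℂ) ≠ 0 := by simpa using hz0
  -- The radial projection `z / ‖z‖` is a point of the circle at distance `|‖z‖ - 1|` from `z`.
  refine Metric.mem_cthickening_of_dist_le z (z / ‖z‖) δ _ (by simp [hz0]) ?_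
  have : z - z / ‖z‖ = (z / ‖z‖) * ((‖z‖ - 1 : ℝ) : ℂ) := by
    push_cast
    field_simp
  rw [dist_eq_norm, this, norm_mul, Complex.norm_real, norm_div, Complex.norm_real, norm_norm,
    div_self (norm_ne_zero_iff.2 hz0), one_mul]
  exact hz.trans (min_le_left _ _)

/-- Cauchy estimate: the Laurent coefficients of a function holomorphic between the unit circle and
the circle `|z| = ρ` are `O(ρ ^ (-n))`. -/
theorem exists_norm_laurentCoeff_le {g : ℂ → ℂ} {ρ : ℝ} (hρ : 0 < ρ)
    (hg : ∀ z : ℂ, ‖z‖ ∈ Set.uIcc 1 ρ → DifferentiableAt ℂ g z) :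
    ∃ C, ∀ n : ℤ, ‖laurentCoeff g n‖ ≤ C * ρ ^ (-n) := by
  have hcont : ContinuousOn g (Metric.sphere 0 ρ) := fun z hz => by
    have hz' : ‖z‖ = ρ := by simpa using hz
    exact (hg z (hz' ▸ Set.right_mem_uIcc)).continuousAt.continuousWithinAt
  obtain ⟨c, hc⟩ := (isCompact_sphere (0 : ℂ) ρ).exists_bound_of_continuousOn hcont
  refine ⟨c, fun n => ?_⟩
  have hmove : (∮ z in C(0, 1), g z / z ^ (n + 1)) = ∮ z in C(0, ρ), g z / z ^ (n + 1) := by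
    refine circleIntegral_eq_of_differentiableAt_annulus one_pos hρ fun z hz => ?_
    have hz0 : z ≠ 0 := by
      rintro rfl
      rw [norm_zero] at hz
      exact absurd hz.1 (not_le.2 (lt_min one_pos hρ))
    exact (hg z hz).div (differentiableAt_id.zpow (Or.inl hz0)) (zpow_ne_zero _ hz0)
  rw [laurentCoeff, hmove]
  refine (circleIntegral.norm_two_pi_i_inv_smul_integral_le_of_norm_le_const (c := (0 : ℂ))
    (C := c / ρ ^ (n + 1)) hρ.le fun z hz => ?_).trans (le_of_eq ?_)
  · have hz' : ‖z‖ = ρ := by simpa using hz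
    rw [norm_div, norm_zpow, hz']
    gcongr
    exact hc z hz
  · rw [zpow_add_one₀ hρ.ne', zpow_neg]
    field_simp

theorem differentiableAt_tsum_pow_of_norm_le {a : ℕ → ℂ} {C ρ : ℝ} (hρ : 0 < ρ)
    (ha : ∀ n, ‖a n‖ ≤ C * ρ ^ (-(n : ℤ))) {z : ℂ} (hz : ‖z‖ < ρ) :
    DifferentiableAt ℂ (fun w => ∑' n : ℕ, a n * w ^ n) z := by
  obtain ⟨r, hzr, hr⟩ := exists_between hz
  have hr0 : 0 < r := (norm_nonneg z).trans_lt hzr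
  have hdiff : DifferentiableOn ℂ (fun w => ∑' n : ℕ, a n * w ^ n) (Metric.ball 0 r) := by
    refine Complex.differentiableOn_tsum_of_summable_norm (u := fun n => C * (r / ρ) ^ n)
      ((summable_geometric_of_lt_one (by positivity) ((div_lt_one hρ).2 hr)).mul_left C)
      (fun n => by fun_prop) Metric.isOpen_ball fun n w hw => ?_
    have hw' : ‖w‖ ≤ r := (mem_ball_zero_iff.1 hw).le
    have h0 := (norm_nonneg _).trans (ha n)
    rw [norm_mul, norm_pow]
    calc ‖a n‖ * ‖w‖ ^ n ≤ C * ρ ^ (-(n : ℤ)) * r ^ n := by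
          gcongr
          exact ha n
      _ = C * (r / ρ) ^ n := by
          rw [zpow_neg, zpow_natCast, div_pow]
          ring
  exact hdiff.differentiableAt (Metric.isOpen_ball.mem_nhds (mem_ball_zero_iff.2 hzr))

/-- The exponent of the Szegő function inside the disc continues holomorphically to a larger
disc. -/
theorem differentiableAt_tsum_laurentCoeff {g : ℂ → ℂ} {ρ : ℝ} (hρ : 0 < ρ)
    (hg : ∀ z : ℂ, ‖z‖ ∈ Set.uIcc 1 ρ → DifferentiableAt ℂ g z) {z : ℂ} (hz : ‖z‖ < ρ) :
    DifferentiableAt ℂ (fun w => ∑' n : ℕ, laurentCoeff g n * w ^ n) z := by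
  obtain ⟨C, hC⟩ := exists_norm_laurentCoeff_le hρ hg
  exact differentiableAt_tsum_pow_of_norm_le hρ (fun n => hC n) hz

/-- The exponent of the Szegő function outside the disc continues holomorphically to the exterior of
a smaller disc. -/
theorem differentiableAt_tsum_laurentCoeff_neg {g : ℂ → ℂ} {ρ : ℝ} (hρ : 0 < ρ)
    (hg : ∀ z : ℂ, ‖z‖ ∈ Set.uIcc 1 ρ → DifferentiableAt ℂ g z) {z : ℂ} (hz : ρ < ‖z‖) :
    DifferentiableAt ℂ
      (fun w => ∑' n : ℕ, laurentCoeff g (-(n + 1 : ℤ)) * w ^ (-(n + 1 : ℤ))) z := by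
  obtain ⟨C, hC⟩ := exists_norm_laurentCoeff_le hρ hg
  have hz0 : z ≠ 0 := norm_pos_iff.1 (hρ.trans hz)
  -- Written this way the sum is a power series in `w⁻¹`, convergent for `|w⁻¹| < ρ⁻¹`.
  have heq : (fun w : ℂ => ∑' n : ℕ, laurentCoeff g (-(n + 1 : ℤ)) * w ^ (-(n + 1 : ℤ))) =
      fun w => w⁻¹ * ∑' n : ℕ, laurentCoeff g (-(n + 1 : ℤ)) * w⁻¹ ^ n := by
    funext w
    rw [← tsum_mul_left]
    refine tsum_congr fun n => ?_
    rw [← inv_zpow', show ((n : ℤ) + 1) = ((n + 1 : ℕ) : ℤ) by push_cast; rfl, zpow_natCast]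
    ring
  rw [heq]
  refine (differentiableAt_inv hz0).mul (DifferentiableAt.comp z
    (g := fun w => ∑' n : ℕ, laurentCoeff g (-(n + 1 : ℤ)) * w ^ n)
    (differentiableAt_tsum_pow_of_norm_le (C := C * ρ) (inv_pos.2 hρ) (fun n => ?_) ?_)
    (differentiableAt_inv hz0))
  · refine (hC _).trans (le_of_eq ?_)
    rw [neg_neg, zpow_add_one₀ hρ.ne', inv_zpow', neg_neg]
    ring
  · rw [norm_inv]
    exact inv_strictAnti₀ hρ hz

/-! ### Calculus of `O(N^{-∞})` -/

namespace IsBigONegInfty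

theorem add {e d : ℕ → ℂ} (he : IsBigONegInfty e) (hd : IsBigONegInfty d) :
    IsBigONegInfty fun N => e N + d N := fun k => (he k).add (hd k)

theorem const_mul {e : ℕ → ℂ} (he : IsBigONegInfty e) (c : ℂ) :
    IsBigONegInfty fun N => c * e N := fun k => (he k).const_mul_left c

theorem of_norm_le_pow {e : ℕ → ℂ} {C q : ℝ} (hq0 : 0 ≤ q) (hq1 : q < 1)
    (h : ∀ N, ‖e N‖ ≤ C * q ^ N) : IsBigONegInfty e := by
  intro k
  have h1 : e =O[atTop] fun N : ℕ => q ^ N := by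
    refine IsBigO.of_bound C (Eventually.of_forall fun N => ?_)
    rw [Real.norm_of_nonneg (pow_nonneg hq0 N)]
    exact h N
  refine h1.trans ?_
  have h2 := (tendsto_pow_const_mul_const_pow_of_abs_lt_one k
    (by rwa [abs_of_nonneg hq0] : |q| < 1)).isBigO_one ℝ
  have h3 := h2.mul (isBigO_refl (fun N : ℕ => ((N : ℝ) ^ k)⁻¹) atTop)
  refine (IsBigO.congr' h3 ?_ ?_)
  · filter_upwards [eventually_gt_atTop 0] with N hN
    have : (N : ℝ) ≠ 0 := by positivity
    field_simp
  · exact Eventually.of_forall fun N => one_mul _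

theorem tendsto {e : ℕ → ℂ} (he : IsBigONegInfty e) : Tendsto e atTop (nhds 0) := by
  refine (he 1).trans_tendsto ?_
  simpa using tendsto_inv_atTop_nhds_zero_nat (𝕜 := ℝ)

/-- If the entries of a matrix are `O(N^{-∞})` close to those of a constant matrix, then so are the
determinants. -/
theorem det_sub_det {ι : Type*} [Fintype ι] [DecidableEq ι] {M : ℕ → Matrix ι ι ℂ}
    {D : Matrix ι ι ℂ} (h : ∀ i j, IsBigONegInfty fun N => M N i j - D i j) :
    IsBigONegInfty fun N => (M N).det - D.det := by
  let F : (ι → ι → ℂ) → ℂ := fun A => (Matrix.of A).det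
  -- Differentiability at the limit gives `F(A) - F(D) = O(A - D)` as the entries converge.
  have hF : DifferentiableAt ℂ F (fun i j => D i j) := by
    simp only [F, Matrix.det_apply', Matrix.of_apply]
    fun_prop
  have hM : Tendsto (fun N => (fun i j => M N i j : ι → ι → ℂ)) atTop
      (nhds fun i j => D i j) := by
    refine tendsto_pi_nhds.2 fun i => tendsto_pi_nhds.2 fun j => ?_
    simpa using (h i j).tendsto.add_const (D i j)
  intro k
  refine (hF.isBigO_sub.comp_tendsto hM).trans ?_
  exact isBigO_pi.2 fun i => isBigO_pi.2 fun j => h i j k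

end IsBigONegInfty

/-! ### Decay of the matrix entries -/

theorem innerDoubleIntegral_szegoAlpha (g : ℂ → ℂ) {ηz ηs : ℝ} (hηz0 : 0 ≤ ηz) (hηz : ηz < 1)
    (hηs0 : 0 ≤ ηs) (hηs : ηs < 1) (u v : ℤ) :
    innerDoubleIntegral (szegoAlpha g) ηz ηs u v =
      cauchyDoubleIntegral (fun z => Complex.exp (-∑' n : ℕ, laurentCoeff g n * z ^ n))
        (fun z => Complex.exp (∑' n : ℕ, laurentCoeff g n * z ^ n)) ηz ηs u v := by
  refine innerDoubleIntegral_eq hηz0 hηs0 (fun z hz => ?_) (fun s hs => ?_) u v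
  · rw [szegoAlpha, if_pos (by rwa [mem_sphere_zero_iff_norm.1 hz])]
  · rw [szegoAlpha, if_pos (by rwa [mem_sphere_zero_iff_norm.1 hs]), ← Complex.exp_neg, neg_neg]

theorem outerDoubleIntegral_szegoAlpha (g : ℂ → ℂ) {ηz ηs : ℝ} (hηz0 : 0 < ηz) (hηz : ηz < 1)
    (hηs0 : 0 < ηs) (hηs : ηs < 1) (u v : ℤ) :
    outerDoubleIntegral (szegoAlpha g) ηz ηs u v =
      cauchyDoubleIntegral
        (fun z => Complex.exp (-∑' n : ℕ, laurentCoeff g (-(n + 1 : ℤ)) * z ^ (-(n + 1 : ℤ))))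
        (fun z => Complex.exp (∑' n : ℕ, laurentCoeff g (-(n + 1 : ℤ)) * z ^ (-(n + 1 : ℤ))))
        ηz⁻¹ ηs⁻¹ u v := by
  refine outerDoubleIntegral_eq hηz0.le hηs0.le (fun z hz => ?_) (fun s hs => ?_) u v
  · rw [szegoAlpha, if_neg, ← Complex.exp_neg]
    rw [mem_sphere_zero_iff_norm.1 hz, not_lt]
    exact ((one_lt_inv₀ hηz0).2 hηz).le
  · rw [szegoAlpha, if_neg]
    rw [mem_sphere_zero_iff_norm.1 hs, not_lt]
    exact ((one_lt_inv₀ hηs0).2 hηs).le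

section Decay

variable {g : ℂ → ℂ} {δ ηz ηs : ℝ}

theorem differentiableAt_tsum_laurentCoeff_of_annulus (hδ : 0 < δ)
    (hg : ∀ z : ℂ, |‖z‖ - 1| ≤ δ → DifferentiableAt ℂ g z) {z : ℂ} (hz : ‖z‖ < 1 + δ) :
    DifferentiableAt ℂ (fun w => ∑' n : ℕ, laurentCoeff g n * w ^ n) z := by
  refine differentiableAt_tsum_laurentCoeff (by positivity) (fun w hw => hg w ?_) hz
  rw [Set.uIcc_of_le (by linarith)] at hw
  rw [abs_le]
  constructor <;> linarith [hw.1, hw.2]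

theorem differentiableAt_tsum_laurentCoeff_neg_of_annulus (hδ : 0 < δ) (hδ1 : δ < 1)
    (hg : ∀ z : ℂ, |‖z‖ - 1| ≤ δ → DifferentiableAt ℂ g z) {z : ℂ} (hz : 1 - δ < ‖z‖) :
    DifferentiableAt ℂ
      (fun w => ∑' n : ℕ, laurentCoeff g (-(n + 1 : ℤ)) * w ^ (-(n + 1 : ℤ))) z := by
  refine differentiableAt_tsum_laurentCoeff_neg (by linarith) (fun w hw => hg w ?_) hz
  rw [Set.uIcc_of_ge (by linarith)] at hw
  rw [abs_le]
  constructor <;> linarith [hw.1, hw.2]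

/-- The `z`-contour moves outward from `ηz` to `ρ`, away from the `s`-contour and possibly past the
unit circle. The constant is uniform in the exponents, which later depend on `N`. -/
theorem exists_norm_innerDoubleIntegral_le (hδ : 0 < δ)
    (hg : ∀ z : ℂ, |‖z‖ - 1| ≤ δ → DifferentiableAt ℂ g z)
    (hηs : 0 < ηs) (hηsz : ηs < ηz) (hηz : ηz < 1) {ρ : ℝ} (hρ : ηz ≤ ρ) (hρδ : ρ < 1 + δ) :
    ∃ C, ∀ u v : ℤ, ‖innerDoubleIntegral (szegoAlpha g) ηz ηs u v‖ ≤ C * (ηs ^ u * ρ ^ v) := by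
  have hηz0 := hηs.trans hηsz
  have hdiff : ∀ z : ℂ, ‖z‖ < 1 + δ → DifferentiableAt ℂ
      (fun w => ∑' n : ℕ, laurentCoeff g n * w ^ n) z := fun z hz =>
    differentiableAt_tsum_laurentCoeff_of_annulus hδ hg hz
  have hB : ContinuousOn (fun z => Complex.exp (∑' n : ℕ, laurentCoeff g n * z ^ n))
      (Metric.sphere 0 ηs) := fun z hz =>
    (hdiff z (by rw [mem_sphere_zero_iff_norm.1 hz]; linarith)).cexp.continuousAt.continuousWithinAt
  have hA : ContinuousOn (fun z => Complex.exp (-∑' n : ℕ, laurentCoeff g n * z ^ n))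
      (Metric.sphere 0 ρ) := fun z hz =>
    (hdiff z (by rwa [mem_sphere_zero_iff_norm.1 hz])).neg.cexp.continuousAt.continuousWithinAt
  obtain ⟨C, hC⟩ := exists_norm_cauchyDoubleIntegral_le (hηz0.trans_le hρ) hηs
    (hηsz.trans_le hρ).ne' hA hB
  refine ⟨C, fun u v => ?_⟩
  rw [innerDoubleIntegral_szegoAlpha g hηz0.le hηz hηs.le (hηsz.trans hηz),
    cauchyDoubleIntegral_eq_of_annulus hηz0 (hηz0.trans_le hρ) hηs (fun h => ?_)
      (fun z hz => ?_) hB]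
  · exact hC u v
  · rw [Set.uIcc_of_le hρ] at h
    exact absurd h.1 (not_le.2 hηsz)
  · rw [Set.uIcc_of_le hρ] at hz
    exact (hdiff z (hz.2.trans_lt hρδ)).neg.cexp

/-- Mirror image: the `z`-contour shrinks from `ηz⁻¹` to `ρ`, staying inside the `s`-contour. -/
theorem exists_norm_outerDoubleIntegral_le (hδ : 0 < δ) (hδ1 : δ < 1)
    (hg : ∀ z : ℂ, |‖z‖ - 1| ≤ δ → DifferentiableAt ℂ g z)
    (hηs : 0 < ηs) (hηsz : ηs < ηz) (hηz : ηz < 1) {ρ : ℝ} (hρ : ρ ≤ ηz⁻¹) (hρδ : 1 - δ < ρ) :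
    ∃ C, ∀ u v : ℤ,
      ‖outerDoubleIntegral (szegoAlpha g) ηz ηs u v‖ ≤ C * (ηs⁻¹ ^ u * ρ ^ v) := by
  have hηz0 := hηs.trans hηsz
  have hρ0 : 0 < ρ := by linarith
  have hinv : ηz⁻¹ < ηs⁻¹ := inv_strictAnti₀ hηs hηsz
  have h1 : 1 < ηz⁻¹ := (one_lt_inv₀ hηz0).2 hηz
  have hdiff : ∀ z : ℂ, 1 - δ < ‖z‖ → DifferentiableAt ℂ
      (fun w => ∑' n : ℕ, laurentCoeff g (-(n + 1 : ℤ)) * w ^ (-(n + 1 : ℤ))) z := fun z hz =>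
    differentiableAt_tsum_laurentCoeff_neg_of_annulus hδ hδ1 hg hz
  have hB : ContinuousOn
      (fun z => Complex.exp (∑' n : ℕ, laurentCoeff g (-(n + 1 : ℤ)) * z ^ (-(n + 1 : ℤ))))
      (Metric.sphere 0 ηs⁻¹) := fun z hz =>
    (hdiff z (by rw [mem_sphere_zero_iff_norm.1 hz]; linarith)).cexp.continuousAt.continuousWithinAt
  have hA : ContinuousOn
      (fun z => Complex.exp (-∑' n : ℕ, laurentCoeff g (-(n + 1 : ℤ)) * z ^ (-(n + 1 : ℤ))))
      (Metric.sphere 0 ρ) := fun z hz =>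
    (hdiff z (by rwa [mem_sphere_zero_iff_norm.1 hz])).neg.cexp.continuousAt.continuousWithinAt
  obtain ⟨C, hC⟩ := exists_norm_cauchyDoubleIntegral_le hρ0 (inv_pos.2 hηs)
    (hρ.trans_lt hinv).ne hA hB
  refine ⟨C, fun u v => ?_⟩
  rw [outerDoubleIntegral_szegoAlpha g hηz0 hηz hηs (hηsz.trans hηz),
    cauchyDoubleIntegral_eq_of_annulus (inv_pos.2 hηz0) hρ0 (inv_pos.2 hηs) (fun h => ?_)
      (fun z hz => ?_) hB]
  · exact hC u v
  · rw [Set.uIcc_of_ge hρ] at h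
    exact absurd h.2 (not_le.2 hinv)
  · rw [Set.uIcc_of_ge hρ] at hz
    exact (hdiff z (hρδ.trans_le hz.1)).neg.cexp

/-- The original contours suffice, with ratio `ηs / ηz < 1`. -/
theorem isBigONegInfty_innerDoubleIntegral_add_sub (hδ : 0 < δ)
    (hg : ∀ z : ℂ, |‖z‖ - 1| ≤ δ → DifferentiableAt ℂ g z)
    (hηs : 0 < ηs) (hηsz : ηs < ηz) (hηz : ηz < 1) (k l : ℤ) :
    IsBigONegInfty fun N : ℕ =>
      innerDoubleIntegral (szegoAlpha g) ηz ηs (N + k) (l - N) := by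
  have hηz0 := hηs.trans hηsz
  obtain ⟨C, hC⟩ := exists_norm_innerDoubleIntegral_le hδ hg hηs hηsz hηz le_rfl (by linarith)
  refine .of_norm_le_pow (C := C * (ηs ^ k * ηz ^ l)) (q := ηs / ηz) (by positivity)
    ((div_lt_one hηz0).2 hηsz) fun N => (hC _ _).trans (le_of_eq ?_)
  rw [zpow_add₀ hηs.ne', zpow_sub₀ hηz0.ne', zpow_natCast, zpow_natCast, div_pow]
  ring

theorem isBigONegInfty_innerDoubleIntegral_add (hδ : 0 < δ)
    (hg : ∀ z : ℂ, |‖z‖ - 1| ≤ δ → DifferentiableAt ℂ g z)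
    (hηs : 0 < ηs) (hηsz : ηs < ηz) (hηz : ηz < 1) (k l : ℤ) :
    IsBigONegInfty fun N : ℕ => innerDoubleIntegral (szegoAlpha g) ηz ηs (N + k) l := by
  obtain ⟨C, hC⟩ := exists_norm_innerDoubleIntegral_le hδ hg hηs hηsz hηz le_rfl (by linarith)
  refine .of_norm_le_pow (C := C * (ηs ^ k * ηz ^ l)) hηs.le (hηsz.trans hηz)
    fun N => (hC _ _).trans (le_of_eq ?_)
  rw [zpow_add₀ hηs.ne', zpow_natCast]
  ring

/-- On the original contour `z^(-N)` grows; it decays only after the move to radius `1 + δ / 2`. -/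
theorem isBigONegInfty_innerDoubleIntegral_sub (hδ : 0 < δ)
    (hg : ∀ z : ℂ, |‖z‖ - 1| ≤ δ → DifferentiableAt ℂ g z)
    (hηs : 0 < ηs) (hηsz : ηs < ηz) (hηz : ηz < 1) (k l : ℤ) :
    IsBigONegInfty fun N : ℕ => innerDoubleIntegral (szegoAlpha g) ηz ηs k (l - N) := by
  have hρ : (0 : ℝ) < 1 + δ / 2 := by positivity
  obtain ⟨C, hC⟩ := exists_norm_innerDoubleIntegral_le (ρ := 1 + δ / 2) hδ hg hηs hηsz hηz
    (by linarith) (by linarith)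
  refine .of_norm_le_pow (C := C * (ηs ^ k * (1 + δ / 2) ^ l)) (q := (1 + δ / 2)⁻¹) (by positivity)
    (inv_lt_one_of_one_lt₀ (by linarith)) fun N => (hC _ _).trans (le_of_eq ?_)
  rw [zpow_sub₀ hρ.ne', zpow_natCast, inv_pow]
  ring

theorem isBigONegInfty_outerDoubleIntegral_add (hδ : 0 < δ) (hδ1 : δ < 1)
    (hg : ∀ z : ℂ, |‖z‖ - 1| ≤ δ → DifferentiableAt ℂ g z)
    (hηs : 0 < ηs) (hηsz : ηs < ηz) (hηz : ηz < 1) (k l : ℤ) :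
    IsBigONegInfty fun N : ℕ => outerDoubleIntegral (szegoAlpha g) ηz ηs k (N + l) := by
  have h1 : 1 < ηz⁻¹ := (one_lt_inv₀ (hηs.trans hηsz)).2 hηz
  -- A radius below one, so that `z^N` decays, yet inside the annulus of continuation.
  have hρ : 0 < 1 - δ / 2 := by linarith
  obtain ⟨C, hC⟩ := exists_norm_outerDoubleIntegral_le (ρ := 1 - δ / 2) hδ hδ1 hg hηs hηsz hηz
    (by linarith) (by linarith)
  refine .of_norm_le_pow (C := C * (ηs⁻¹ ^ k * (1 - δ / 2) ^ l)) hρ.le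
    (by linarith) fun N => (hC _ _).trans (le_of_eq ?_)
  rw [zpow_add₀ hρ.ne', zpow_natCast]
  ring

/-- Up to `O(N^{-∞})`, the lacunary matrix is block diagonal with blocks `M⁽⁻⁾` and `M⁽⁺⁾`. -/
theorem isBigONegInfty_lacunaryMatrix_sub_fromBlocks (hδ : 0 < δ) (hδ1 : δ < 1)
    (hg : ∀ z : ℂ, |‖z‖ - 1| ≤ δ → DifferentiableAt ℂ g z)
    (hηs : 0 < ηs) (hηsz : ηs < ηz) (hηz : ηz < 1)
    {nm np : ℕ} {pm hm : Fin nm → ℤ} {pp hp : Fin np → ℤ}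
    (hpm1 : ∀ a, 1 ≤ pm a) (hpp1 : ∀ a, 1 ≤ pp a) (i j : Fin nm ⊕ Fin np) :
    IsBigONegInfty fun N : ℕ =>
      (lacunaryMatrix (szegoAlpha g) ηz ηs N (lacunaryP pm pp N)
        (lacunaryH hm hp N)).submatrix finSumFinEquiv finSumFinEquiv i j -
      Matrix.fromBlocks (matrixMinus (szegoAlpha g) ηz ηs pm hm) 0 0
        (matrixPlus (szegoAlpha g) ηz ηs pp hp) i j := by
  rcases i with a | a
  · have ha : 0 ≤ -(1 - pm a) := by linarith [hpm1 a]
    rcases j with b | b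
    -- The inner term survives only for `pm a = 1`, where both indicators equal one; the outer term
    -- cancels exactly against `M⁽⁻⁾`.
    · convert! (isBigONegInfty_innerDoubleIntegral_add_sub hδ hg hηs hηsz hηz (pm a - 1)
        (hm b - 1)).const_mul (-(if 0 ≤ 1 - pm a then 1 else 0)) using 2 with N
      simp only [lacunaryMatrix, lacunaryP, lacunaryH, matrixMinus, Matrix.submatrix_apply,
        finSumFinEquiv_apply_left, Matrix.of_apply, Fin.append_left, if_pos ha,
        Matrix.fromBlocks_apply₁₁, one_mul]
      rw [show -(1 - pm a) = pm a - 1 by ring, show (N : ℤ) - (1 - pm a) = N + (pm a - 1) by ring,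
        show hm b - N - 1 = hm b - 1 - N by ring, add_sub_cancel_right]
    · convert! ((isBigONegInfty_innerDoubleIntegral_add hδ hg hηs hηsz hηz (pm a - 1)
        (-hp b)).const_mul (-(if 0 ≤ 1 - pm a then 1 else 0))).add
        (isBigONegInfty_outerDoubleIntegral_add hδ hδ1 hg hηs hηsz hηz (pm a - 1) (-hp b))
        using 2 with N
      simp only [lacunaryMatrix, lacunaryP, lacunaryH, Matrix.submatrix_apply,
        finSumFinEquiv_apply_left, finSumFinEquiv_apply_right, Matrix.of_apply, Fin.append_left,
        Fin.append_right, if_pos ha, Matrix.fromBlocks_apply₁₂, one_mul, Matrix.zero_apply,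
        sub_zero]
      rw [show -(1 - pm a) = pm a - 1 by ring, show (N : ℤ) - (1 - pm a) = N + (pm a - 1) by ring,
        show (N : ℤ) + 1 - hp b - N - 1 = -hp b by ring,
        show (N : ℤ) + 1 - hp b - 1 = N + -hp b by ring]
  · have ha : ∀ N : ℕ, 0 ≤ pp a + N := fun N => by linarith [hpp1 a, N.cast_nonneg (α := ℤ)]
    have ha' : ∀ N : ℕ, ¬0 ≤ -(pp a + N) := fun N => by linarith [hpp1 a, N.cast_nonneg (α := ℤ)]
    rcases j with b | b
    · convert! (isBigONegInfty_innerDoubleIntegral_sub hδ hg hηs hηsz hηz (-pp a)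
        (hm b - 1)).const_mul (-1) using 2 with N
      simp only [lacunaryMatrix, lacunaryP, lacunaryH, Matrix.submatrix_apply,
        finSumFinEquiv_apply_left, finSumFinEquiv_apply_right, Matrix.of_apply, Fin.append_left,
        Fin.append_right, if_pos (ha N), if_neg (ha' N), Matrix.fromBlocks_apply₂₁, zero_mul,
        add_zero, Matrix.zero_apply, sub_zero]
      rw [show (N : ℤ) - (pp a + N) = -pp a by ring, show hm b - N - 1 = hm b - 1 - N by ring]
    -- Here the powers of `N` cancel and the entry equals that of `M⁽⁺⁾` exactly.
    · refine IsBigONegInfty.of_norm_le_pow (C := 0) le_rfl one_pos fun N => ?_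
      simp only [lacunaryMatrix, lacunaryP, lacunaryH, matrixPlus, Matrix.submatrix_apply,
        finSumFinEquiv_apply_right, Matrix.of_apply, Fin.append_right, if_pos (ha N),
        if_neg (ha' N), Matrix.fromBlocks_apply₂₂, zero_mul, add_zero]
      rw [show (N : ℤ) - (pp a + N) = -pp a by ring,
        show (N : ℤ) + 1 - hp b - N - 1 = -hp b by ring]
      simp

end Decay

theorem mainTheorem4
    (f logf : ℂ → ℂ) (U : Set ℂ) (hU : IsOpen U) (hcircle : Metric.sphere (0 : ℂ) 1 ⊆ U)
    (hf0 : ∀ z ∈ Metric.sphere (0 : ℂ) 1, f z ≠ 0)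
    (hf : DifferentiableOn ℂ f U) (hlogf : DifferentiableOn ℂ logf U)
    (hexp : ∀ z ∈ U, Complex.exp (logf z) = f z)
    (nm np : ℕ) (pm hm : Fin nm → ℤ) (pp hp : Fin np → ℤ)
    (hpm1 : ∀ a, 1 ≤ pm a) (hhm1 : ∀ a, 1 ≤ hm a)
    (hpp1 : ∀ a, 1 ≤ pp a) (hhp1 : ∀ a, 1 ≤ hp a)
    (ηz ηs : ℝ) (hηs : 0 < ηs) (hηsz : ηs < ηz) (hηz : ηz < 1)
    (hplus : (matrixPlus (szegoAlpha logf) ηz ηs pp hp).det ≠ 0)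
    (hminus : (matrixMinus (szegoAlpha logf) ηz ηs pm hm).det ≠ 0) :
    ∃ ε : ℕ → ℂ, IsBigONegInfty ε ∧ ∀ N : ℕ,
      (lacunaryMatrix (szegoAlpha logf) ηz ηs N (lacunaryP pm pp N) (lacunaryH hm hp N)).det =
        (matrixPlus (szegoAlpha logf) ηz ηs pp hp).det *
          (matrixMinus (szegoAlpha logf) ηz ηs pm hm).det * (1 + ε N) := by
  obtain ⟨δ, hδ, hδ1, hδU⟩ := exists_annulus_subset_of_sphere_subset hU hcircle
  have hg : ∀ z : ℂ, |‖z‖ - 1| ≤ δ → DifferentiableAt ℂ logf z := fun z hz =>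
    hlogf.differentiableAt (hU.mem_nhds (hδU z hz))
  have hdet := IsBigONegInfty.det_sub_det
    (isBigONegInfty_lacunaryMatrix_sub_fromBlocks (hm := hm) (hp := hp) hδ hδ1 hg hηs hηsz hηz
      hpm1 hpp1)
  simp only [Matrix.det_submatrix_equiv_self, Matrix.det_fromBlocks_zero₂₁] at hdet
  -- `ε` is the determinant error divided by the nonzero limit.
  refine ⟨_, hdet.const_mul ((matrixPlus (szegoAlpha logf) ηz ηs pp hp).det *
    (matrixMinus (szegoAlpha logf) ηz ηs pm hm).det)⁻¹, fun N => ?_⟩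
  field_simp
  ring
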